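/- Let $\mathcal A$ be a unital algebra over $\mathbb C$, let $\varphi:\mathcal A\to\mathbb C$ be a linear functional with $\varphi(1_{\mathcal A})=1$, and let $a\in\mathcal A$ be such that $\varphi(a)=1$. Let $M_a(z)=\sum_{n\ge 1}\varphi(a^n)z^n\in\mathbb C[[z]]$ be the moment series of $a$, let $M_a^{\langle -1\rangle}$ be its inverse under composition of formal power series, and let $$S_a(z)=\frac{1+z}{z}\,M_a^{\langle -1\rangle}(z)\in\mathbb C[[z]]$$ be the $S$-transform of $a$, a series with constant term $1$. Write its reciprocal (the inverse under multiplication) as $1/S_a(z)=\sum_{n=0}^{\infty}t_nz^n$. Let $NC(n)$ be the set of non-crossing partitions of $\{1,\dots,n\}$, that is, of those partitions for which there are no two distinct blocks $V,W$ and elements $v,v'\in V$, $w,w'\in W$ with $v<w<v'<w'$. A block $V$ of $\alpha\in NC(n)$ is called inner if there is a block $V'$ of $\alpha$ with $\min(V')<\min(V)$ and $\max(V')>\max(V)$, and outer otherwise. Then for every $n\ge 1$, $$\varphi(a^n)=\sum_{\alpha\in NC(n)}\ \Bigl(\prod_{\substack{U\in\alpha\\ U\text{ outer}}}t_{|U|-1}\Bigr)\cdot\Bigl(\prod_{\substack{V\in\alpha\\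 V\text{ inner}}}\bigl(t_{|V|-1}+t_{|V|}\bigr)\Bigr),$$ where empty products are equal to $1$. -/

import Mathlib

namespace FreeProb

open scoped PowerSeries

section Partitions

variable {n : ℕ}

/-- A partition of an `n`-element linearly ordered set is non-crossing if there are no two
distinct blocks `V`, `W` with elements `v < w < v' < w'`, where `v, v' ∈ V` and `w, w' ∈ W`. -/
def IsNoncrossing (α : Finpartition (Finset.univ : Finset (Fin n))) : Prop :=
  ∀ V ∈ α.parts, ∀ W ∈ α.parts, V ≠ W →
    ∀ v ∈ V, ∀ v' ∈ V, ∀ w ∈ W, ∀ w' ∈ W, ¬ (v < w ∧ w < v' ∧ v' < w')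

set_option synthInstance.maxSize 1000 in
set_option synthInstance.maxHeartbeats 200000 in
instance : DecidablePred (IsNoncrossing (n := n)) := fun α => by
  unfold IsNoncrossing
  infer_instance

/-- The block `V` of `α` is inner if some block `V'` of `α` satisfies
`min V' < min V` and `max V < max V'`. -/
def IsInner (α : Finpartition (Finset.univ : Finset (Fin n))) (V : Finset (Fin n)) : Prop :=
  ∃ V' ∈ α.parts, V'.min < V.min ∧ V.max < V'.max

instance (α : Finpartition (Finset.univ : Finset (Fin n))) : DecidablePred (IsInner α) :=
  fun V => by
    unfold IsInner
    infer_instance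

/-- The blocks of `α` that are inner. -/
def innerBlocks (α : Finpartition (Finset.univ : Finset (Fin n))) : Finset (Finset (Fin n)) :=
  α.parts.filter (fun V => IsInner α V)

/-- The blocks of `α` that are outer, that is, not inner. -/
def outerBlocks (α : Finpartition (Finset.univ : Finset (Fin n))) : Finset (Finset (Fin n)) :=
  α.parts.filter (fun V => ¬ IsInner α V)

/-- The set `NC(n)` of non-crossing partitions. -/
def NC (n : ℕ) : Finset (Finpartition (Finset.univ : Finset (Fin n))) :=
  Finset.univ.filter (fun α => IsNoncrossing α)

end Partitions

section STransform

variable {A : Type*} [Ring A] [Algebra ℂ A]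

/-- The moment series `∑_{n ≥ 1} φ(aⁿ) zⁿ`. -/
noncomputable def momentSeries (φ : A →ₗ[ℂ] ℂ) (a : A) : ℂ⟦X⟧ :=
  PowerSeries.mk fun n => if n = 0 then 0 else φ (a ^ n)

theorem isUnit_coeff_one_momentSeries (φ : A →ₗ[ℂ] ℂ) (a : A) (ha : φ a = 1) :
    IsUnit ((momentSeries φ a).coeff 1) := by
  simp [momentSeries, ha]

/-- The inverse of the moment series under composition. -/
noncomputable def momentSeriesInv (φ : A →ₗ[ℂ] ℂ) (a : A) (ha : φ a = 1) : ℂ⟦X⟧ :=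
  (momentSeries φ a).substInvOfIsUnit (isUnit_coeff_one_momentSeries φ a ha)

/-- The S-transform `S_a(z) = ((1 + z) / z) M_a^{⟨-1⟩}(z)`. The series `M_a^{⟨-1⟩}` has zero
constant term, and dividing it by `z` shifts its coefficients. -/
noncomputable def sTransform (φ : A →ₗ[ℂ] ℂ) (a : A) (ha : φ a = 1) : ℂ⟦X⟧ :=
  (1 + PowerSeries.X) * PowerSeries.mk fun n => (momentSeriesInv φ a ha).coeff (n + 1)

end STransform

end FreeProb

/-!
Write `M` for the moment series and `T = 1 / S_a = ∑ tₙ zⁿ`. The definition of the `S`-transform says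
`z = (1 + z) T(z) M^{⟨-1⟩}(z)`; substituting `M` for `z` turns this into the functional equation
`M = z (1 + M) T(M)` (`momentSeries_eq`).

On the combinatorial side, let `m` be the least element of the ground set. In a non-crossing
partition either `{m}` is a block, or `m` has a successor `c` in its block. In the second case, the
elements strictly between `m` and `c` are partitioned into blocks of their own, all of them inner,
and the rest is a partition of the elements from `c` on, with `m` added to the block of `c`. So the
weighted sum over non-crossing partitions satisfies a recursion in which the block of the least
element remembers how many elements it has absorbed (`ncSum_insert`). By induction, its values
depend only on the size of the ground set, and any power series that satisfy the corresponding
equations have them as coefficients (`ncSum_eq_coeff`).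

For the outer weights `t_{k-1}` and the inner weights `t_{k-1} + t_k`, solutions can be written down:
`F = 1 + M` for the sum itself, `G = (1 + M) T(M) = M / z` for the sum in which all blocks have the
inner weight, and series built from the tails `∑ₖ t_{p+k} zᵏ` of `T`, evaluated at `M`, for the
intermediate sums. The functional equation of `M` gives the required identities
(`ncSum_eq_coeff_one_add`).
-/

namespace FreeProb

open Finset
open scoped PowerSeries

/-! ### Decomposition of non-crossing partitions at the least element -/

section Noncrossing

variable {α : Type*} [LinearOrder α]

/-- `P` is the set of blocks of a non-crossing partition of the finite set `s`. The ground set is an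
arbitrary finite subset of a linear order, so that restricting a partition to a subset needs no
relabelling, and `P` is a bare set of blocks, so that partitions of different sets have the same
type. -/
structure IsNCPartition (s : Finset α) (P : Finset (Finset α)) : Prop where
  nonempty : ∀ V ∈ P, V.Nonempty
  subset : ∀ V ∈ P, V ⊆ s
  cover : ∀ x ∈ s, ∃ V ∈ P, x ∈ V
  eq_of_mem : ∀ V ∈ P, ∀ W ∈ P, ∀ x, x ∈ V → x ∈ W → V = W
  noncrossing : ∀ V ∈ P, ∀ W ∈ P, ∀ v ∈ V, ∀ v' ∈ V, ∀ w ∈ W, ∀ w' ∈ W,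
    v < w → w < v' → v' < w' → V = W

open Classical in
/-- The finite set of non-crossing partitions of `s`. -/
noncomputable def ncPartitions (s : Finset α) : Finset (Finset (Finset α)) :=
  s.powerset.powerset.filter (IsNCPartition s)

theorem mem_ncPartitions {s : Finset α} {P : Finset (Finset α)} :
    P ∈ ncPartitions s ↔ IsNCPartition s P := by
  simp only [ncPartitions, mem_filter, mem_powerset, and_iff_right_iff_imp]
  exact fun h V hV => mem_powerset.2 (h.subset V hV)

/-- `V` lies strictly below one element and strictly above another element of some `W ∈ P`. For a
block `V` of `P` this says that `V` is inner. -/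
def IsCovered (P : Finset (Finset α)) (V : Finset α) : Prop :=
  ∃ W ∈ P, (∃ x ∈ W, ∀ y ∈ V, x < y) ∧ ∃ x ∈ W, ∀ y ∈ V, y < x

/-- Adds `m` to the set `V` if `V` contains `c`. -/
def addMin (m c : α) (V : Finset α) : Finset α := if c ∈ V then insert m V else V

/-- The union of the partitions `P` and `Q`, with `m` put into the block of `Q` that contains `c`. It
is used with `m` below everything, `c` the least element of the ground set of `Q`, and all blocks of
`P` between `m` and `c`. -/
def attach (m c : α) (P Q : Finset (Finset α)) : Finset (Finset α) := P ∪ Q.image (addMin m c)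

theorem mem_addMin {m c x : α} {V : Finset α} :
    x ∈ addMin m c V ↔ x ∈ V ∨ (x = m ∧ c ∈ V) := by
  unfold addMin; split_ifs with h <;> simp [h, or_comm]

theorem addMin_erase {m c : α} (hmc : m < c) {V : Finset α} (h : m ∈ V → c ∈ V)
    (h' : c ∈ V → m ∈ V) : addMin m c (V.erase m) = V := by
  ext x
  simp only [mem_addMin, mem_erase]
  grind

theorem erase_addMin {m c : α} {V : Finset α} (h : m ∉ V) : (addMin m c V).erase m = V := by
  ext x
  simp only [mem_addMin, mem_erase]
  grind

theorem IsNCPartition.attach {m c : α} {s₁ s₂ : Finset α} {P Q : Finset (Finset α)}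
    (hm : ∀ x ∈ s₁, m < x) (hs₁ : ∀ x ∈ s₁, x < c) (hmc : m < c) (hc : c ∈ s₂)
    (hs₂ : ∀ x ∈ s₂, c ≤ x) (hP : IsNCPartition s₁ P) (hQ : IsNCPartition s₂ Q) :
    IsNCPartition (insert m (s₁ ∪ s₂)) (attach m c P Q) := by
  have hP₁ : ∀ V ∈ P, ∀ x ∈ V, m < x ∧ x < c := fun V hV x hx =>
    ⟨hm x (hP.subset V hV hx), hs₁ x (hP.subset V hV hx)⟩
  have hQ₁ : ∀ V ∈ Q, ∀ x ∈ V, c ≤ x := fun V hV x hx => hs₂ x (hQ.subset V hV hx)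
  have hmem : ∀ V, V ∈ FreeProb.attach m c P Q ↔ V ∈ P ∨ ∃ W ∈ Q, addMin m c W = V := by
    simp [FreeProb.attach]
  constructor
  · intro V hV
    rcases (hmem V).1 hV with h | ⟨W, hW, rfl⟩
    · exact hP.nonempty V h
    · obtain ⟨x, hx⟩ := hQ.nonempty W hW
      exact ⟨x, mem_addMin.2 (Or.inl hx)⟩
  · intro V hV x hx
    rcases (hmem V).1 hV with h | ⟨W, hW, rfl⟩
    · have := hP.subset V h hx
      simp [this]
    · rcases mem_addMin.1 hx with h | ⟨rfl, -⟩
      · have := hQ.subset W hW h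
        simp [this]
      · simp
  · intro x hx
    simp only [mem_insert, mem_union] at hx
    rcases hx with rfl | hx | hx
    · obtain ⟨W, hW, hcW⟩ := hQ.cover c hc
      exact ⟨_, (hmem _).2 (Or.inr ⟨W, hW, rfl⟩), mem_addMin.2 (Or.inr ⟨rfl, hcW⟩)⟩
    · obtain ⟨W, hW, hxW⟩ := hP.cover x hx
      exact ⟨W, (hmem _).2 (Or.inl hW), hxW⟩
    · obtain ⟨W, hW, hxW⟩ := hQ.cover x hx
      exact ⟨_, (hmem _).2 (Or.inr ⟨W, hW, rfl⟩), mem_addMin.2 (Or.inl hxW)⟩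
  · intro V hV W hW x hxV hxW
    rcases (hmem V).1 hV with h | ⟨V, h, rfl⟩ <;> rcases (hmem W).1 hW with h' | ⟨W, h', rfl⟩
    · exact hP.eq_of_mem V h W h' x hxV hxW
    · rw [mem_addMin] at hxW
      grind
    · rw [mem_addMin] at hxV
      grind
    · rw [mem_addMin] at hxV hxW
      have : V = W := by
        rcases hxV with hxV | ⟨rfl, hxV⟩ <;> rcases hxW with hxW | ⟨hx, hxW⟩
        · exact hQ.eq_of_mem V h W h' x hxV hxW
        · grind
        · grind
        · exact hQ.eq_of_mem V h W h' c hxV hxW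
      rw [this]
  · intro V hV W hW v hv v' hv' w hw w' hw' h₁ h₂ h₃
    rcases (hmem V).1 hV with h | ⟨V, h, rfl⟩ <;> rcases (hmem W).1 hW with h' | ⟨W, h', rfl⟩
    · exact hP.noncrossing V h W h' v hv v' hv' w hw w' hw' h₁ h₂ h₃
    · rw [mem_addMin] at hw hw'
      grind
    · rw [mem_addMin] at hv hv'
      grind
    · rw [mem_addMin] at hv hv' hw hw'
      have hv'V : v' ∈ V := by grind
      have hw'W : w' ∈ W := by grind
      have hwW : w ∈ W := by grind
      have : V = W := by
        rcases hv with hv | ⟨rfl, hv⟩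
        · exact hQ.noncrossing V h W h' v hv v' hv'V w hwW w' hw'W h₁ h₂ h₃
        -- If the crossing starts at `m`, then it may start at `c` as well, unless `c = w`.
        · rcases (hQ₁ W h' w hwW).eq_or_lt with rfl | hlt
          · exact hQ.eq_of_mem V h W h' _ hv hwW
          · exact hQ.noncrossing V h W h' c hv v' hv'V w hwW w' hw'W hlt h₂ h₃
      rw [this]

/-- Some block of `P` contains `m` and `c`, and all its elements other than `m` are at least `c`. If
`m` is the least element of the ground set, `c` is the successor of `m` in its block. -/
def IsNext (m c : α) (P : Finset (Finset α)) : Prop :=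
  ∃ V ∈ P, m ∈ V ∧ c ∈ V ∧ ∀ x ∈ V, x ≠ m → c ≤ x

open Classical in
/-- The blocks of `P` that lie entirely below `c`. -/
noncomputable def below (c : α) (P : Finset (Finset α)) : Finset (Finset α) :=
  P.filter fun V => ∀ x ∈ V, x < c

open Classical in
/-- The blocks of `P` that do not lie entirely below `c`, with `m` removed from them. -/
noncomputable def above (m c : α) (P : Finset (Finset α)) : Finset (Finset α) :=
  (P.filter fun V => ¬ ∀ x ∈ V, x < c).image fun V => V.erase m

variable {m c : α} {s : Finset α} {P Q : Finset (Finset α)}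

/-- If `c` is the successor of `m`, no block straddles `c`, except for the element `m`: a block with
elements on both sides of `c` would cross the block of `m` and `c`. -/
theorem IsNCPartition.le_of_not_below (hm : ∀ x ∈ s, m < x) (hP : IsNCPartition (insert m s) P)
    (h : IsNext m c P) {V : Finset α} (hV : V ∈ P) (hVc : ¬ ∀ x ∈ V, x < c) :
    ∀ x ∈ V, x ≠ m → c ≤ x := by
  obtain ⟨U, hU, hmU, hcU, hUc⟩ := h
  push Not at hVc
  obtain ⟨y, hy, hcy⟩ := hVc
  by_cases hUV : U = V
  · subst hUV
    exact hUc
  · intro x hx hxm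
    by_contra! hxc
    have hmx : m < x := by have := hP.subset V hV hx; grind
    rcases hcy.eq_or_lt with rfl | hlt
    · exact hUV (hP.eq_of_mem U hU V hV _ hcU hy)
    · exact hUV (hP.noncrossing U hU V hV m hmU c hcU x hx y hy hmx hxc hlt)

theorem IsNCPartition.mem_iff_of_isNext (hP : IsNCPartition (insert m s) P)
    (h : IsNext m c P) {V : Finset α} (hV : V ∈ P) : m ∈ V ↔ c ∈ V := by
  obtain ⟨U, hU, hmU, hcU, hUc⟩ := h
  constructor
  · intro hx
    rwa [← hP.eq_of_mem U hU V hV _ hmU hx]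
  · intro hx
    rwa [← hP.eq_of_mem U hU V hV _ hcU hx]

theorem IsNCPartition.below (hP : IsNCPartition (insert m s) P)
    (hm : ∀ x ∈ s, m < x) (h : IsNext m c P) :
    IsNCPartition (s.filter (· < c)) (below c P) := by
  have key := fun V hV => hP.le_of_not_below hm h (V := V) hV
  have hiff := fun V hV => hP.mem_iff_of_isNext h (V := V) hV
  have hmem : ∀ V, V ∈ FreeProb.below c P ↔ V ∈ P ∧ ∀ x ∈ V, x < c := by simp [FreeProb.below]
  constructor
  · intro V hV
    exact hP.nonempty V ((hmem V).1 hV).1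
  · intro V hV x hx
    obtain ⟨hV, hVc⟩ := (hmem V).1 hV
    have := hP.subset V hV hx
    have := hiff V hV
    grind
  · intro x hx
    rw [mem_filter] at hx
    obtain ⟨V, hV, hxV⟩ := hP.cover x (mem_insert_of_mem hx.1)
    refine ⟨V, (hmem V).2 ⟨hV, ?_⟩, hxV⟩
    by_contra hVc
    exact absurd (key V hV hVc x hxV (hm x hx.1).ne') (not_le.2 hx.2)
  · intro V hV W hW
    exact hP.eq_of_mem V ((hmem V).1 hV).1 W ((hmem W).1 hW).1
  · intro V hV W hW
    exact hP.noncrossing V ((hmem V).1 hV).1 W ((hmem W).1 hW).1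

theorem IsNCPartition.above (hP : IsNCPartition (insert m s) P)
    (hm : ∀ x ∈ s, m < x) (hc : c ∈ s) (h : IsNext m c P) :
    IsNCPartition (s.filter (c ≤ ·)) (above m c P) := by
  have key := fun V hV => hP.le_of_not_below hm h (V := V) hV
  have hmem : ∀ V, V ∈ FreeProb.above m c P ↔ ∃ W ∈ P, (¬ ∀ x ∈ W, x < c) ∧ W.erase m = V := by
    simp [FreeProb.above, and_assoc]
  constructor
  · intro V' hV'
    obtain ⟨V, hV, hVc, rfl⟩ := (hmem V').1 hV'
    push Not at hVc
    obtain ⟨x, hx, hcx⟩ := hVc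
    exact ⟨x, mem_erase.2 ⟨((hm c hc).trans_le hcx).ne', hx⟩⟩
  · intro V' hV' x hx
    obtain ⟨V, hV, hVc, rfl⟩ := (hmem V').1 hV'
    rw [mem_erase] at hx
    have := hP.subset V hV hx.2
    have := key V hV hVc x hx.2 hx.1
    grind
  · intro x hx
    rw [mem_filter] at hx
    obtain ⟨V, hV, hxV⟩ := hP.cover x (mem_insert_of_mem hx.1)
    refine ⟨_, (hmem _).2 ⟨V, hV, ?_, rfl⟩, ?_⟩
    · intro hV
      exact absurd (hV x hxV) (not_lt.2 hx.2)
    · simp [hxV, (hm x hx.1).ne']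
  · intro V' hV' W' hW' x hxV hxW
    obtain ⟨V, hV, hVc, rfl⟩ := (hmem V').1 hV'
    obtain ⟨W, hW, hWc, rfl⟩ := (hmem W').1 hW'
    rw [hP.eq_of_mem V hV W hW x (mem_of_mem_erase hxV) (mem_of_mem_erase hxW)]
  · intro V' hV' W' hW' v hv v' hv' w hw w' hw' h₁ h₂ h₃
    obtain ⟨V, hV, hVc, rfl⟩ := (hmem V').1 hV'
    obtain ⟨W, hW, hWc, rfl⟩ := (hmem W').1 hW'
    rw [hP.noncrossing V hV W hW v (mem_of_mem_erase hv) v' (mem_of_mem_erase hv')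
      w (mem_of_mem_erase hw) w' (mem_of_mem_erase hw') h₁ h₂ h₃]

end Noncrossing

/-! ### Weighted sums over non-crossing partitions -/

section Weight

variable {α : Type*} [LinearOrder α] {m c : α} {s : Finset α} {P Q : Finset (Finset α)}

theorem disjoint_image_addMin {s₁ s₂ : Finset α}
    (hs₁ : ∀ x ∈ s₁, x < c) (hs₂ : ∀ x ∈ s₂, c ≤ x) (hP : IsNCPartition s₁ P)
    (hQ : IsNCPartition s₂ Q) : Disjoint P (Q.image (addMin m c)) := by
  rw [disjoint_left]
  intro V hV hV'
  obtain ⟨W, hW, rfl⟩ := mem_image.1 hV'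
  obtain ⟨x, hx⟩ := hQ.nonempty W hW
  have h₁ := hs₁ x (hP.subset _ hV (mem_addMin.2 (Or.inl hx)))
  exact absurd h₁ (not_lt.2 (hs₂ x (hQ.subset W hW hx)))

theorem injOn_addMin {s₂ : Finset α} (hm : ∀ x ∈ s₂, m < x) (hQ : IsNCPartition s₂ Q) :
    Set.InjOn (addMin m c) (Q : Set (Finset α)) := by
  have h : ∀ V ∈ Q, m ∉ V := fun V hV hmV => lt_irrefl m (hm m (hQ.subset V hV hmV))
  intro V hV W hW hVW
  rw [← erase_addMin (c := c) (h V hV), hVW, erase_addMin (h W hW)]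

theorem below_attach {s₁ s₂ : Finset α}
    (hs₁ : ∀ x ∈ s₁, x < c) (hs₂ : ∀ x ∈ s₂, c ≤ x) (hP : IsNCPartition s₁ P)
    (hQ : IsNCPartition s₂ Q) : below c (attach m c P Q) = P := by
  ext V
  simp only [below, attach, mem_filter, mem_union, mem_image]
  constructor
  · rintro ⟨h | ⟨W, hW, rfl⟩, h'⟩
    · exact h
    · obtain ⟨x, hx⟩ := hQ.nonempty W hW
      exact absurd (h' x (mem_addMin.2 (Or.inl hx))) (not_lt.2 (hs₂ x (hQ.subset W hW hx)))
  · exact fun h => ⟨Or.inl h, fun x hx => hs₁ x (hP.subset V h hx)⟩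

theorem above_attach {s₁ s₂ : Finset α} (hm : ∀ x ∈ s₂, m < x)
    (hs₁ : ∀ x ∈ s₁, x < c) (hs₂ : ∀ x ∈ s₂, c ≤ x) (hP : IsNCPartition s₁ P)
    (hQ : IsNCPartition s₂ Q) : above m c (attach m c P Q) = Q := by
  have h : ∀ V ∈ Q, m ∉ V := fun V hV hmV => lt_irrefl m (hm m (hQ.subset V hV hmV))
  ext V
  simp only [above, attach, mem_filter, mem_union, mem_image]
  constructor
  · rintro ⟨V, ⟨hV | ⟨W, hW, rfl⟩, h'⟩, rfl⟩
    · exact absurd (fun x hx => hs₁ x (hP.subset V hV hx)) h'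
    · rwa [erase_addMin (h W hW)]
  · intro hV
    refine ⟨addMin m c V, ⟨Or.inr ⟨V, hV, rfl⟩, fun h' => ?_⟩, erase_addMin (h V hV)⟩
    obtain ⟨x, hx⟩ := hQ.nonempty V hV
    exact absurd (h' x (mem_addMin.2 (Or.inl hx))) (not_lt.2 (hs₂ x (hQ.subset V hV hx)))

theorem attach_below_above (hmc : m < c) (hP : IsNCPartition (insert m s) P)
    (h : IsNext m c P) : attach m c (below c P) (above m c P) = P := by
  classical
  have hV : ∀ V ∈ P, addMin m c (V.erase m) = V := fun V hV =>
    addMin_erase hmc (hP.mem_iff_of_isNext h hV).1 (hP.mem_iff_of_isNext h hV).2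
  rw [attach, below, above, image_image, image_congr (g := id), image_id, filter_union_filter_not_eq]
  intro V hV'
  exact hV V (mem_filter.1 hV').1

theorem isNext_attach {s₂ : Finset α} (hc : c ∈ s₂) (hs₂ : ∀ x ∈ s₂, c ≤ x)
    (hQ : IsNCPartition s₂ Q) : IsNext m c (attach m c P Q) := by
  obtain ⟨V, hV, hcV⟩ := hQ.cover c hc
  refine ⟨addMin m c V, mem_union_right _ (mem_image_of_mem _ hV), mem_addMin.2 (Or.inr ⟨rfl, hcV⟩),
    mem_addMin.2 (Or.inl hcV), fun x hx hxm => ?_⟩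
  rcases mem_addMin.1 hx with h | h
  · exact hs₂ x (hQ.subset V hV h)
  · exact absurd h.1 hxm

/-- The block that contains `m` and `c` covers every block of `P`. -/
theorem isCovered_attach_left {s₁ s₂ : Finset α} (hm : ∀ x ∈ s₁, m < x) (hs₁ : ∀ x ∈ s₁, x < c)
    (hc : c ∈ s₂) (hP : IsNCPartition s₁ P) (hQ : IsNCPartition s₂ Q) {V : Finset α}
    (hV : V ∈ P) : IsCovered (attach m c P Q) V := by
  obtain ⟨W, hW, hcW⟩ := hQ.cover c hc
  exact ⟨addMin m c W, mem_union_right _ (mem_image_of_mem _ hW),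
    ⟨m, mem_addMin.2 (Or.inr ⟨rfl, hcW⟩), fun y hy => hm y (hP.subset V hV hy)⟩,
    ⟨c, mem_addMin.2 (Or.inl hcW), fun y hy => hs₁ y (hP.subset V hV hy)⟩⟩

theorem isCovered_attach_right {s₁ s₂ : Finset α} (hm : ∀ x ∈ s₂, m < x)
    (hs₁ : ∀ x ∈ s₁, x < c) (hs₂ : ∀ x ∈ s₂, c ≤ x)
    (hP : IsNCPartition s₁ P) (hQ : IsNCPartition s₂ Q) {V : Finset α}
    (hV : V ∈ Q) : IsCovered (attach m c P Q) (addMin m c V) ↔ IsCovered Q V := by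
  have hQm : ∀ W ∈ Q, ∀ x ∈ W, m < x ∧ c ≤ x := fun W hW x hx =>
    ⟨hm x (hQ.subset W hW hx), hs₂ x (hQ.subset W hW hx)⟩
  obtain ⟨z, hz⟩ := hQ.nonempty V hV
  have hzV : z ∈ addMin m c V := mem_addMin.2 (Or.inl hz)
  constructor
  · rintro ⟨W, hW, ⟨x, hx, hxV⟩, ⟨y, hy, hyV⟩⟩
    have hzy := hyV z hzV
    have hcz := hQm V hV z hz
    rcases mem_union.1 hW with hW | hW
    · exact absurd (hs₁ y (hP.subset W hW hy)) (not_lt.2 (hcz.2.trans hzy.le))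
    · obtain ⟨W, hWQ, rfl⟩ := mem_image.1 hW
      rw [mem_addMin] at hx hy
      have hyW : y ∈ W := by grind
      refine ⟨W, hWQ, ?_, y, hyW, fun v hv => hyV v (mem_addMin.2 (Or.inl hv))⟩
      rcases hx with hx | ⟨rfl, hcW⟩
      · exact ⟨x, hx, fun v hv => hxV v (mem_addMin.2 (Or.inl hv))⟩
      · have hcV : c ∉ V := fun hcV => lt_irrefl x (hxV x (mem_addMin.2 (Or.inr ⟨rfl, hcV⟩)))
        refine ⟨c, hcW, fun v hv => (hQm V hV v hv).2.lt_of_ne ?_⟩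
        rintro rfl
        exact hcV hv
  · rintro ⟨W, hW, ⟨x, hx, hxV⟩, ⟨y, hy, hyV⟩⟩
    have hcV : c ∉ V := fun hcV => absurd (hxV c hcV) (not_lt.2 (hQm W hW x hx).2)
    have hV' : addMin m c V = V := if_neg hcV
    rw [hV']
    exact ⟨addMin m c W, mem_union_right _ (mem_image_of_mem _ hW),
      ⟨x, mem_addMin.2 (Or.inl hx), hxV⟩, ⟨y, mem_addMin.2 (Or.inl hy), hyV⟩⟩

variable {R : Type*} [CommSemiring R]

open Classical in
/-- The product of the weights `i V` of the inner blocks and `o V` of the outer blocks of `P`. -/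
noncomputable def blockWeight (o i : Finset α → R) (P : Finset (Finset α)) : R :=
  ∏ V ∈ P, if IsCovered P V then i V else o V

/-- The sum of `blockWeight o i` over the non-crossing partitions of `s`. The weight of a block may
depend on the block itself, and not only on its size: this lets `ncSum_insert` absorb an element
added to a block into the weight function. -/
noncomputable def ncSum (o i : Finset α → R) (s : Finset α) : R :=
  ∑ P ∈ ncPartitions s, blockWeight o i P

theorem blockWeight_attach (o i : Finset α → R) {s₁ s₂ : Finset α} (hm₁ : ∀ x ∈ s₁, m < x)
    (hm : ∀ x ∈ s₂, m < x) (hs₁ : ∀ x ∈ s₁, x < c) (hc : c ∈ s₂) (hs₂ : ∀ x ∈ s₂, c ≤ x)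
    (hP : IsNCPartition s₁ P) (hQ : IsNCPartition s₂ Q) :
    blockWeight o i (attach m c P Q) =
      blockWeight i i P * blockWeight (fun V => o (addMin m c V)) (fun V => i (addMin m c V)) Q := by
  classical
  rw [blockWeight, attach, prod_union (disjoint_image_addMin hs₁ hs₂ hP hQ),
    prod_image (injOn_addMin hm hQ), blockWeight, blockWeight]
  congr 1
  · refine prod_congr rfl fun V hV => ?_
    rw [ite_self]
    exact if_pos (isCovered_attach_left hm₁ hs₁ hc hP hQ hV)
  · refine prod_congr rfl fun V hV => ?_
    exact if_congr (isCovered_attach_right hm hs₁ hs₂ hP hQ hV) rfl rfl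

/-- The weight `i` matters only for blocks without the least element `c` of `s`, since the block of
`c` is outer. -/
theorem ncSum_congr {o o' i i' : Finset α → R} (hs : ∀ x ∈ s, c ≤ x)
    (ho : ∀ V ⊆ s, V.Nonempty → o V = o' V)
    (hi : ∀ V ⊆ s, V.Nonempty → c ∉ V → i V = i' V) : ncSum o i s = ncSum o' i' s := by
  classical
  refine sum_congr rfl fun P hP => prod_congr rfl fun V hV => ?_
  rw [mem_ncPartitions] at hP
  split_ifs with h
  · refine hi V (hP.subset V hV) (hP.nonempty V hV) fun hcV => ?_
    obtain ⟨W, hW, ⟨x, hx, hxV⟩, -⟩ := h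
    exact absurd (hxV c hcV) (not_lt.2 (hs x (hP.subset W hW hx)))
  · exact ho V (hP.subset V hV) (hP.nonempty V hV)

/-- The partitions in which `c` is the successor of `m` are the `attach m c P Q`. The blocks of `P` are
all inner, and those of `Q` keep their type. -/
theorem sum_isNext (o i : Finset α → R) (hm : ∀ x ∈ s, m < x) (hc : c ∈ s)
    [DecidablePred (IsNext m c)] :
    ∑ P ∈ (ncPartitions (insert m s)).filter (IsNext m c), blockWeight o i P =
      ncSum i i (s.filter (· < c)) *
        ncSum (fun V => o (addMin m c V)) i (s.filter (c ≤ ·)) := by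
  have hs₁ : ∀ x ∈ s.filter (· < c), x < c := fun x hx => (mem_filter.1 hx).2
  have hs₂ : ∀ x ∈ s.filter (c ≤ ·), c ≤ x := fun x hx => (mem_filter.1 hx).2
  have hm₁ : ∀ x ∈ s.filter (· < c), m < x := fun x hx => hm x (mem_filter.1 hx).1
  have hm₂ : ∀ x ∈ s.filter (c ≤ ·), m < x := fun x hx => hm x (mem_filter.1 hx).1
  have hc₂ : c ∈ s.filter (c ≤ ·) := mem_filter.2 ⟨hc, le_rfl⟩
  have hs : s.filter (· < c) ∪ s.filter (c ≤ ·) = s := by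
    simp_rw [← not_lt]
    exact filter_union_filter_not_eq _ _
  rw [← ncSum_congr (i := fun V => i (addMin m c V)) hs₂ (fun _ _ _ => rfl)
    fun V _ _ hcV => by rw [addMin, if_neg hcV], ncSum, ncSum, sum_mul_sum, ← sum_product']
  refine sum_bij' (fun P _ => (below c P, above m c P)) (fun p _ => attach m c p.1 p.2)
    ?_ ?_ ?_ ?_ ?_
  · intro P hP
    rw [mem_filter, mem_ncPartitions] at hP
    rw [mem_product, mem_ncPartitions, mem_ncPartitions]
    exact ⟨hP.1.below hm hP.2, hP.1.above hm hc hP.2⟩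
  · rintro ⟨P, Q⟩ h
    rw [mem_product, mem_ncPartitions, mem_ncPartitions] at h
    rw [mem_filter, mem_ncPartitions]
    refine ⟨?_, isNext_attach hc₂ hs₂ h.2⟩
    have := h.1.attach hm₁ hs₁ (hm c hc) hc₂ hs₂ h.2
    rwa [hs] at this
  · intro P hP
    rw [mem_filter, mem_ncPartitions] at hP
    exact attach_below_above (hm c hc) hP.1 hP.2
  · rintro ⟨P, Q⟩ h
    rw [mem_product, mem_ncPartitions, mem_ncPartitions] at h
    exact Prod.ext (below_attach hs₁ hs₂ h.1 h.2) (above_attach hm₂ hs₁ hs₂ h.1 h.2)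
  · intro P hP
    rw [mem_filter, mem_ncPartitions] at hP
    rw [← blockWeight_attach o i hm₁ hm₂ hs₁ hc₂ hs₂ (hP.1.below hm hP.2)
      (hP.1.above hm hc hP.2), attach_below_above (hm c hc) hP.1 hP.2]

theorem IsNCPartition.insert_singleton (hm : ∀ x ∈ s, m < x) (hP : IsNCPartition s P) :
    IsNCPartition (insert m s) (insert {m} P) := by
  have h : ∀ V ∈ P, ∀ x ∈ V, m < x := fun V hV x hx => hm x (hP.subset V hV hx)
  obtain ⟨h₁, h₂, h₃, h₄, h₅⟩ := hP
  constructor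
  · grind
  · intro V hV
    rcases mem_insert.1 hV with rfl | hV
    · simp
    · exact (h₂ V hV).trans (subset_insert _ _)
  · intro x hx
    rcases mem_insert.1 hx with rfl | hx
    · exact ⟨{x}, by simp, by simp⟩
    · obtain ⟨V, hV, hxV⟩ := h₃ x hx
      exact ⟨V, mem_insert_of_mem hV, hxV⟩
  · intro V hV W hW x hx hx'
    rw [mem_insert] at hV hW
    rcases hV with rfl | hV <;> rcases hW with rfl | hW
    · rfl
    · grind
    · grind
    · exact h₄ V hV W hW x hx hx'
  · intro V hV W hW v hv v' hv' w hw w' hw' h₁ h₂ h₃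
    rw [mem_insert] at hV hW
    rcases hV with rfl | hV <;> rcases hW with rfl | hW
    · rfl
    · grind
    · grind
    · exact h₅ V hV W hW v hv v' hv' w hw w' hw' h₁ h₂ h₃

theorem IsNCPartition.erase_singleton (hms : m ∉ s) (hP : IsNCPartition (insert m s) P)
    (h : {m} ∈ P) : IsNCPartition s (P.erase {m}) := by
  have hne : ∀ V ∈ P.erase {m}, m ∉ V := fun V hV hmV =>
    (mem_erase.1 hV).1 (hP.eq_of_mem V (mem_of_mem_erase hV) {m} h m hmV (mem_singleton_self m))
  constructor
  · exact fun V hV => hP.nonempty V (mem_of_mem_erase hV)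
  · intro V hV x hx
    have := hP.subset V (mem_of_mem_erase hV) hx
    have := hne V hV
    grind
  · intro x hx
    obtain ⟨V, hV, hxV⟩ := hP.cover x (mem_insert_of_mem hx)
    refine ⟨V, mem_erase.2 ⟨?_, hV⟩, hxV⟩
    rintro rfl
    exact hms (mem_singleton.1 hxV ▸ hx)
  · exact fun V hV W hW => hP.eq_of_mem V (mem_of_mem_erase hV) W (mem_of_mem_erase hW)
  · exact fun V hV W hW => hP.noncrossing V (mem_of_mem_erase hV) W (mem_of_mem_erase hW)

theorem blockWeight_insert_singleton (o i : Finset α → R) (hm : ∀ x ∈ s, m < x)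
    (hP : IsNCPartition s P) :
    blockWeight o i (insert {m} P) = o {m} * blockWeight o i P := by
  classical
  have h : ∀ V ∈ P, ∀ x ∈ V, m < x := fun V hV x hx => hm x (hP.subset V hV hx)
  have hmP : {m} ∉ P := fun hmP => lt_irrefl m (h _ hmP m (mem_singleton_self m))
  have hm' : ¬ IsCovered (insert {m} P) {m} := by
    rintro ⟨W, hW, ⟨x, hx, hxm⟩, -⟩
    have := hxm m (mem_singleton_self m)
    rcases mem_insert.1 hW with rfl | hW
    · exact this.ne (mem_singleton.1 hx)
    · exact this.not_gt (h W hW x hx)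
  rw [blockWeight, prod_insert hmP, if_neg hm', blockWeight]
  congr 1
  refine prod_congr rfl fun V hV => if_congr ?_ rfl rfl
  obtain ⟨z, hz⟩ := hP.nonempty V hV
  constructor
  · rintro ⟨W, hW, hx, ⟨y, hy, hyV⟩⟩
    rcases mem_insert.1 hW with rfl | hW
    · rw [mem_singleton] at hy
      exact absurd (hyV z hz) (hy ▸ (h V hV z hz).not_gt)
    · exact ⟨W, hW, hx, y, hy, hyV⟩
  · rintro ⟨W, hW, hx⟩
    exact ⟨W, mem_insert_of_mem hW, hx⟩

theorem sum_singleton_mem (o i : Finset α → R) (hm : ∀ x ∈ s, m < x) :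
    ∑ P ∈ (ncPartitions (insert m s)).filter ({m} ∈ ·), blockWeight o i P =
      o {m} * ncSum o i s := by
  have hms : m ∉ s := fun h => lt_irrefl m (hm m h)
  rw [ncSum, mul_sum]
  refine sum_bij' (fun P _ => P.erase {m}) (fun P _ => insert {m} P) ?_ ?_ ?_ ?_ ?_
  · intro P hP
    rw [mem_filter, mem_ncPartitions] at hP
    exact mem_ncPartitions.2 (hP.1.erase_singleton hms hP.2)
  · intro P hP
    rw [mem_ncPartitions] at hP
    exact mem_filter.2 ⟨mem_ncPartitions.2 (hP.insert_singleton hm), mem_insert_self _ _⟩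
  · intro P hP
    exact insert_erase (mem_filter.1 hP).2
  · intro P hP
    rw [mem_ncPartitions] at hP
    exact erase_insert fun h => hms (hP.subset _ h (mem_singleton_self m))
  · intro P hP
    rw [mem_filter, mem_ncPartitions] at hP
    rw [← blockWeight_insert_singleton o i hm (hP.1.erase_singleton hms hP.2), insert_erase hP.2]

/-- Recursion on the least element `m`: either `{m}` is a block, or `m` has a successor `c` in its
block. In the latter case the elements between `m` and `c` form inner blocks only, and `m` may be
merged into `c`. -/
theorem ncSum_insert (o i : Finset α → R) (hm : ∀ x ∈ s, m < x) :
    ncSum o i (insert m s) = o {m} * ncSum o i s +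
      ∑ c ∈ s, ncSum i i (s.filter (· < c)) *
        ncSum (fun V => o (addMin m c V)) i (s.filter (c ≤ ·)) := by
  classical
  have hms : m ∉ s := fun h => lt_irrefl m (hm m h)
  rw [ncSum, ← sum_filter_add_sum_filter_not _ ({m} ∈ ·), sum_singleton_mem o i hm]
  congr 1
  rw [← sum_congr rfl fun c hc => sum_isNext o i hm hc, ← sum_biUnion]
  · refine sum_congr ?_ fun _ _ => rfl
    ext P
    simp only [mem_filter, mem_biUnion, mem_ncPartitions]
    constructor
    · rintro ⟨hP, hmP⟩
      obtain ⟨V, hV, hmV⟩ := hP.cover m (mem_insert_self m s)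
      have hne : (V.erase m).Nonempty := by
        rw [nonempty_iff_ne_empty]
        intro h
        rcases (erase_eq_empty_iff V m).1 h with h | h
        · simp [h] at hmV
        · exact hmP (h ▸ hV)
      have hmin := mem_erase.1 ((V.erase m).min'_mem hne)
      refine ⟨(V.erase m).min' hne, mem_of_mem_insert_of_ne (hP.subset V hV hmin.2) hmin.1,
        hP, V, hV, hmV, hmin.2, fun x hx hxm => min'_le _ _ (mem_erase.2 ⟨hxm, hx⟩)⟩
    · rintro ⟨c, hc, hP, V, hV, hmV, hcV, -⟩
      refine ⟨hP, fun h => ?_⟩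
      have := hP.eq_of_mem V hV _ h m hmV (mem_singleton_self m)
      rw [this, mem_singleton] at hcV
      exact hms (hcV ▸ hc)
  · intro c hc d hd hcd
    rw [Function.onFun, disjoint_left]
    intro P hPc hPd
    obtain ⟨hP, V, hV, hmV, hcV, hVc⟩ := mem_filter.1 hPc
    obtain ⟨-, W, hW, hmW, hdW, hWd⟩ := mem_filter.1 hPd
    obtain rfl := (mem_ncPartitions.1 hP).eq_of_mem V hV W hW m hmV hmW
    exact hcd (le_antisymm (hVc d hdW (hm d hd).ne') (hWd c hcV (hm c hc).ne'))

theorem ncSum_empty (o i : Finset α → R) : ncSum o i ∅ = 1 := by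
  have h : ncPartitions (∅ : Finset α) = {∅} := by
    ext P
    rw [mem_ncPartitions, mem_singleton]
    constructor
    · refine fun hP => eq_empty_of_forall_notMem fun V hV => ?_
      exact (hP.nonempty V hV).ne_empty (subset_empty.1 (hP.subset V hV))
    · rintro rfl
      constructor <;> simp
  rw [ncSum, h, sum_singleton, blockWeight, prod_empty]

end Weight

/-! ### Generating functions -/

section GeneratingFunction

variable {α : Type*} [LinearOrder α] {R : Type*} [CommSemiring R]

/-- An element `c` of `s` is determined by the number `j` of elements of `s` below it, and `j` runs
through all numbers less than the size of `s`. -/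
theorem sum_card_filter_lt {M : Type*} [AddCommMonoid M] (s : Finset α) (h : ℕ → ℕ → M) :
    ∑ c ∈ s, h (s.filter (· < c)).card (s.filter (c ≤ ·)).card =
      ∑ j ∈ range s.card, h j (s.card - j) := by
  have hlt : ∀ c ∈ s, (s.filter (· < c)).card < s.card := fun c hc =>
    card_lt_card (filter_ssubset.2 ⟨c, hc, lt_irrefl c⟩)
  have hinj : Set.InjOn (fun c => (s.filter (· < c)).card) (s : Set α) := by
    have key : ∀ c ∈ s, ∀ d ∈ s, c < d → (s.filter (· < c)).card < (s.filter (· < d)).card :=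
      fun c hc d hd hcd => card_lt_card (Finset.ssubset_iff_subset_ne.2
        ⟨fun x hx => by grind, fun h => by
          have : c ∈ s.filter (· < d) := mem_filter.2 ⟨hc, hcd⟩
          rw [← h, mem_filter] at this
          exact lt_irrefl c this.2⟩)
    intro c hc d hd hcd
    rcases lt_trichotomy c d with h | h | h
    · exact absurd hcd (key c hc d hd h).ne
    · exact h
    · exact absurd hcd (key d hd c hc h).ne'
  have himage : s.image (fun c => (s.filter (· < c)).card) = range s.card := by
    apply eq_of_subset_of_card_le
    · intro j hj
      obtain ⟨c, hc, rfl⟩ := mem_image.1 hj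
      exact mem_range.2 (hlt c hc)
    · rw [card_image_of_injOn hinj, card_range]
  rw [← himage, sum_image hinj]
  refine sum_congr rfl fun c _ => ?_
  have := card_filter_add_card_filter_not (s := s) (· < c)
  simp_rw [not_lt] at this
  rw [← this, Nat.add_sub_cancel_left]

/-- The sum in which the block of the least element `m` is treated as if it had `p` more elements.
The assumption on `B` is the generating function form of `ncSum_insert`, and `G` generates the sums
in which all blocks have the inner weight. -/
theorem ncSum_eq_coeff_of_minBlock {o i : ℕ → R} {F G : R⟦X⟧} {B : ℕ → R⟦X⟧} (hF : F = 1 + B 0)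
    (hB : ∀ p, B p = PowerSeries.X *
      (PowerSeries.C (o (p + 1)) * F + G * B (p + 1))) {N : ℕ}
    (hG : ∀ s : Finset α, s.card < N →
      ncSum (fun V => i V.card) (fun V => i V.card) s = PowerSeries.coeff s.card G)
    (n : ℕ) (hn : n ≤ N) (s : Finset α) (hs : s.card = n) (m : α) (hms : m ∈ s)
    (hm : ∀ x ∈ s, m ≤ x) (p : ℕ) :
    ncSum (fun V => o (if m ∈ V then V.card + p else V.card)) (fun V => i V.card) s =
      PowerSeries.coeff n (B p) := by
  induction n using Nat.strong_induction_on generalizing s m p with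
  | _ n ih =>
  have hB₀ : ∀ p, PowerSeries.coeff 0 (B p) = 0 := fun p => by
    rw [hB, PowerSeries.coeff_zero_X_mul]
  obtain ⟨s, hmn, rfl⟩ : ∃ t, m ∉ t ∧ insert m t = s :=
    ⟨s.erase m, notMem_erase m s, insert_erase hms⟩
  have hlt : ∀ x ∈ s, m < x := fun x hx =>
    (hm x (mem_insert_of_mem hx)).lt_of_ne (by rintro rfl; exact hmn hx)
  rw [card_insert_of_notMem hmn] at hs
  subst hs
  have hFs : ncSum (fun V => o (if m ∈ V then V.card + p else V.card)) (fun V => i V.card) s =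
      PowerSeries.coeff s.card F := by
    rcases s.eq_empty_or_nonempty with rfl | hne
    · rw [ncSum_empty, hF, map_add, card_empty, hB₀, add_zero, PowerSeries.coeff_zero_one]
    · rw [hF, map_add, PowerSeries.coeff_one, if_neg (card_pos.2 hne).ne', zero_add,
        ← ih s.card (Nat.lt_succ_self _) (by omega) s rfl (s.min' hne) (s.min'_mem hne)
          (fun x hx => s.min'_le x hx) 0]
      refine ncSum_congr (c := s.min' hne) (fun x hx => s.min'_le x hx) (fun V hV _ => ?_)
        fun _ _ _ _ => rfl
      rw [if_neg fun h => hmn (hV h), add_zero, ite_self]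
  have hterm : ∀ c ∈ s,
      ncSum (fun V => i V.card) (fun V => i V.card) (s.filter (· < c)) *
        ncSum (fun V => o (if m ∈ addMin m c V then (addMin m c V).card + p
          else (addMin m c V).card)) (fun V => i V.card) (s.filter (c ≤ ·)) =
      PowerSeries.coeff (s.filter (· < c)).card G *
        PowerSeries.coeff (s.filter (c ≤ ·)).card (B (p + 1)) := by
    intro c hc
    have h₁ : (s.filter (· < c)).card < s.card :=
      card_lt_card (filter_ssubset.2 ⟨c, hc, lt_irrefl c⟩)
    have h₂ : (s.filter (c ≤ ·)).card ≤ s.card := card_filter_le _ _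
    have hle : ∀ x ∈ s.filter (c ≤ ·), c ≤ x := fun x hx => (mem_filter.1 hx).2
    rw [hG _ (by omega), ← ih _ (by omega) (by omega) (s.filter (c ≤ ·)) rfl c
      (mem_filter.2 ⟨hc, le_rfl⟩) hle (p + 1)]
    congr 1
    refine ncSum_congr hle (fun V hV _ => ?_) fun _ _ _ _ => rfl
    have hmV : m ∉ V := fun h => hmn (mem_filter.1 (hV h)).1
    by_cases hcV : c ∈ V
    · rw [addMin, if_pos hcV, if_pos hcV, if_pos (mem_insert_self m V), card_insert_of_notMem hmV,
        add_assoc, add_comm 1 p]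
    · rw [addMin, if_neg hcV, if_neg hcV, if_neg hmV]
  -- On the right, the term with second index `0` vanishes, as `B (p + 1)` is divisible by `X`.
  rw [ncSum_insert _ _ hlt, hFs, sum_congr rfl hterm,
    sum_card_filter_lt s fun j k => PowerSeries.coeff j G * PowerSeries.coeff k (B (p + 1)),
    hB p, PowerSeries.coeff_succ_X_mul, map_add, PowerSeries.coeff_C_mul, PowerSeries.coeff_mul,
    Nat.sum_antidiagonal_eq_sum_range_succ
      (fun j k => PowerSeries.coeff j G * PowerSeries.coeff k (B (p + 1))),
    sum_range_succ, Nat.sub_self, hB₀, mul_zero, add_zero, if_pos (mem_singleton_self m),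
    card_singleton, add_comm 1 p]

theorem ncSum_eq_coeff_of_lt {o i : ℕ → R} {F G : R⟦X⟧} {B : ℕ → R⟦X⟧} (hF : F = 1 + B 0)
    (hB : ∀ p, B p = PowerSeries.X *
      (PowerSeries.C (o (p + 1)) * F + G * B (p + 1))) (s : Finset α)
    (hG : ∀ t : Finset α, t.card < s.card →
      ncSum (fun V => i V.card) (fun V => i V.card) t = PowerSeries.coeff t.card G) :
    ncSum (fun V => o V.card) (fun V => i V.card) s = PowerSeries.coeff s.card F := by
  rcases s.eq_empty_or_nonempty with rfl | hne
  · rw [ncSum_empty, hF, map_add, card_empty, hB, PowerSeries.coeff_zero_X_mul, add_zero,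
      PowerSeries.coeff_zero_one]
  · rw [hF, map_add, PowerSeries.coeff_one, if_neg (card_pos.2 hne).ne', zero_add,
      ← ncSum_eq_coeff_of_minBlock hF hB hG s.card le_rfl s rfl (s.min' hne) (s.min'_mem hne)
        (fun x hx => s.min'_le x hx) 0]
    simp_rw [add_zero, ite_self]

/-- Series that solve the recursions of `ncSum_insert` generate the sums over non-crossing partitions:
`G` with the inner weight `i` for all blocks, and `F` with the weights `o` and `i`. -/
theorem ncSum_eq_coeff {o i : ℕ → R} {F G : R⟦X⟧} {B D : ℕ → R⟦X⟧}
    (hF : F = 1 + B 0) (hG : G = 1 + D 0)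
    (hB : ∀ p, B p = PowerSeries.X * (PowerSeries.C (o (p + 1)) * F + G * B (p + 1)))
    (hD : ∀ p, D p = PowerSeries.X * (PowerSeries.C (i (p + 1)) * G + G * D (p + 1)))
    (s : Finset α) :
    ncSum (fun V => o V.card) (fun V => i V.card) s = PowerSeries.coeff s.card F := by
  have key : ∀ s : Finset α,
      ncSum (fun V => i V.card) (fun V => i V.card) s = PowerSeries.coeff s.card G := by
    intro s
    induction hn : s.card using Nat.strong_induction_on generalizing s with
    | _ n ih =>
    rw [← hn]
    exact ncSum_eq_coeff_of_lt hG hD s fun t ht => ih _ (hn ▸ ht) t rfl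
  exact ncSum_eq_coeff_of_lt hF hB s fun t _ => key t

end GeneratingFunction

/-! ### The solution in terms of the functional equation -/

section Substitution

variable {R : Type*} [CommRing R]

theorem subst_mk_eq {M : R⟦X⟧} (hM : PowerSeries.HasSubst M) (w : ℕ → R) :
    (PowerSeries.mk w).subst M =
      PowerSeries.C (w 0) + M * (PowerSeries.mk fun k => w (k + 1)).subst M := by
  have h : PowerSeries.mk w =
      PowerSeries.C (w 0) + PowerSeries.X * PowerSeries.mk fun k => w (k + 1) := by
    ext (_ | n)
    · simp
    · simp [PowerSeries.coeff_succ_X_mul]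
  conv_lhs => rw [h]
  rw [PowerSeries.subst_add hM, PowerSeries.subst_mul hM, PowerSeries.subst_X hM,
    PowerSeries.subst_C]
  rfl

/-- Here the solutions of the recursions are explicit: `F = 1 + M`, and `G = (1 + M) T(M)`, so that
`X * G = M`. The tails `T p` of the series `T`, evaluated at `M`, give the other members of the two
families. -/
theorem ncSum_eq_coeff_one_add {α : Type*} [LinearOrder α] {t : ℕ → R} (ht : t 0 = 1)
    {M : R⟦X⟧} (hM₀ : PowerSeries.HasSubst M)
    (hM : M = PowerSeries.X * ((1 + M) * (PowerSeries.mk t).subst M)) (s : Finset α) :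
    ncSum (fun V => t (V.card - 1)) (fun V => t (V.card - 1) + t V.card) s =
      PowerSeries.coeff s.card (1 + M) := by
  set T : ℕ → R⟦X⟧ := fun p => (PowerSeries.mk fun k => t (p + k)).subst M with hT
  have hT₀ : (PowerSeries.mk t).subst M = T 0 := by simp [hT]
  have hrec : ∀ p, T p = PowerSeries.C (t p) + M * T (p + 1) := by
    intro p
    rw [hT]
    dsimp only
    rw [subst_mk_eq hM₀, add_zero]
    simp_rw [← add_assoc, add_right_comm p _ 1]
  rw [hT₀] at hM
  have h₀ := hrec 0
  rw [ht, map_one] at h₀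
  refine ncSum_eq_coeff (o := fun k => t (k - 1)) (i := fun k => t (k - 1) + t k)
    (G := (1 + M) * T 0)
    (B := fun p => PowerSeries.X * (1 + M) * T p)
    (D := fun p => PowerSeries.X * ((1 + M) * T 0) * (T p + T (p + 1))) ?_ ?_ ?_ ?_ s
  · linear_combination hM
  · rw [← mul_assoc] at hM
    linear_combination (T 0 + T 1) * hM + h₀
  · intro p
    simp only [Nat.add_sub_cancel]
    linear_combination PowerSeries.X * (1 + M) * hrec p +
      PowerSeries.X * (1 + M) * T (p + 1) * hM
  · intro p
    simp only [Nat.add_sub_cancel, map_add]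
    linear_combination PowerSeries.X * ((1 + M) * T 0) * (hrec p + hrec (p + 1)) +
      PowerSeries.X * ((1 + M) * T 0) * (T (p + 1) + T (p + 1 + 1)) * hM

end Substitution

/-! ### The functional equation of the moment series -/

section Moments

variable {A : Type*} [Ring A] [Algebra ℂ A] (φ : A →ₗ[ℂ] ℂ) (a : A) (ha : φ a = 1)

theorem constantCoeff_momentSeries : (momentSeries φ a).constantCoeff = 0 := by
  simp [momentSeries]

theorem constantCoeff_sTransform : (sTransform φ a ha).constantCoeff = 1 := by
  have h : (momentSeriesInv φ a ha).coeff 1 = 1 := by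
    have hu : (isUnit_coeff_one_momentSeries φ a ha).unit = 1 := by
      ext; simp [momentSeries, ha]
    rw [momentSeriesInv, PowerSeries.coeff_one_substInvOfIsUnit, hu, inv_one, Units.val_one]
  rw [sTransform, map_mul, ← PowerSeries.coeff_zero_eq_constantCoeff_apply (PowerSeries.mk _),
    PowerSeries.coeff_mk]
  simp [h]

theorem X_mul_sTransform :
    PowerSeries.X * sTransform φ a ha = (1 + PowerSeries.X) * momentSeriesInv φ a ha := by
  have h := PowerSeries.eq_X_mul_shift_add_const (momentSeriesInv φ a ha)
  rw [show (momentSeriesInv φ a ha).constantCoeff = 0 from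
    PowerSeries.constantCoeff_substInvOfIsUnit .., map_zero, add_zero] at h
  conv_rhs => rw [h]
  rw [sTransform]
  ring

/-- The functional equation of the moment series `M`, for `T = 1 / S`. By definition of `S`,
`X = (1 + X) T K` with `K` the compositional inverse of `M`; substitute `M`, using `K(M) = X`. -/
theorem momentSeries_eq {T : ℂ⟦X⟧} (hT : T * sTransform φ a ha = 1) :
    momentSeries φ a =
      PowerSeries.X * ((1 + momentSeries φ a) * T.subst (momentSeries φ a)) := by
  have hM : PowerSeries.HasSubst (momentSeries φ a) :=
    PowerSeries.HasSubst.of_constantCoeff_zero' (constantCoeff_momentSeries φ a)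
  have hK : (momentSeriesInv φ a ha).subst (momentSeries φ a) = PowerSeries.X :=
    PowerSeries.subst_substInvOfIsUnit_left _ (constantCoeff_momentSeries φ a) _
  have h : PowerSeries.X = (1 + PowerSeries.X) * T * momentSeriesInv φ a ha := by
    linear_combination T * X_mul_sTransform φ a ha - PowerSeries.X * hT
  have h' := congrArg (PowerSeries.substAlgHom hM) h
  simp only [map_mul, map_add, map_one, PowerSeries.substAlgHom_X] at h'
  rw [PowerSeries.coe_substAlgHom, hK] at h'
  linear_combination h'

end Moments

/-! ### Sums over `NC n` -/

section Finpartition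

variable {n : ℕ}

/-- The sum over `NC n` as a sum over sets of blocks. -/
theorem sum_NC {R : Type*} [CommSemiring R] (o i : Finset (Fin n) → R) :
    ∑ α ∈ NC n, (∏ U ∈ outerBlocks α, o U) * ∏ V ∈ innerBlocks α, i V = ncSum o i univ := by
  classical
  have hcov : ∀ α : Finpartition (univ : Finset (Fin n)), ∀ V ∈ α.parts,
      (IsInner α V ↔ IsCovered α.parts V) := by
    intro α V hV
    have hne := α.nonempty_of_mem_parts hV
    refine exists_congr fun W => and_congr_right fun hW => and_congr ?_ ?_
    · rw [Finset.min, Finset.inf_lt_iff]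
      refine exists_congr fun x => and_congr_right fun hx => ?_
      rw [Finset.min, Finset.lt_inf_iff (WithTop.coe_lt_top x)]
      simp
    · rw [Finset.max, Finset.max, Finset.lt_sup_iff]
      refine exists_congr fun x => and_congr_right fun hx => ?_
      rw [Finset.sup_lt_iff (WithBot.bot_lt_coe x)]
      simp
  refine sum_bij (fun α _ => α.parts) ?_ ?_ ?_ ?_
  · intro α hα
    rw [NC, mem_filter] at hα
    rw [mem_ncPartitions]
    refine ⟨fun V hV => α.nonempty_of_mem_parts hV, fun V _ => subset_univ V,
      fun x _ => α.exists_mem (mem_univ x), fun V hV W hW x => α.eq_of_mem_parts hV hW,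
      fun V hV W hW v hv v' hv' w hw w' hw' h₁ h₂ h₃ => ?_⟩
    by_contra hne
    exact hα.2 V hV W hW hne v hv v' hv' w hw w' hw' ⟨h₁, h₂, h₃⟩
  · exact fun α _ β _ h => Finpartition.ext h
  · intro P hP
    rw [mem_ncPartitions] at hP
    refine ⟨⟨P, ?_, ?_, ?_⟩, ?_, rfl⟩
    · rw [supIndep_iff_pairwiseDisjoint]
      intro V hV W hW hne
      rw [Function.onFun, id, id, disjoint_left]
      exact fun x hx hx' => hne (hP.eq_of_mem V hV W hW x hx hx')
    · refine eq_univ_of_forall fun x => ?_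
      obtain ⟨V, hV, hx⟩ := hP.cover x (mem_univ x)
      exact mem_sup.2 ⟨V, hV, hx⟩
    · exact fun h => (hP.nonempty _ h).ne_empty rfl
    · rw [NC, mem_filter]
      exact ⟨mem_univ _, fun V hV W hW hne v hv v' hv' w hw w' hw' h =>
        hne (hP.noncrossing V hV W hW v hv v' hv' w hw w' hw' h.1 h.2.1 h.2.2)⟩
  · intro α _
    rw [blockWeight, prod_ite, mul_comm, innerBlocks, outerBlocks]
    congr 1
    · exact prod_congr (filter_congr fun V hV => hcov α V hV) fun _ _ => rfl
    · exact prod_congr (filter_congr fun V hV => not_congr (hcov α V hV)) fun _ _ => rfl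

end Finpartition
end FreeProb

theorem theorem4p5 {A : Type*} [Ring A] [Algebra ℂ A] (φ : A →ₗ[ℂ] ℂ) (hφ : φ 1 = 1)
    (a : A) (ha : φ a = 1) (t : ℕ → ℂ)
    (ht : (FreeProb.sTransform φ a ha)⁻¹ = PowerSeries.mk t)
    (n : ℕ) (hn : 1 ≤ n) :
    φ (a ^ n) =
      ∑ α ∈ FreeProb.NC n,
        (∏ U ∈ FreeProb.outerBlocks α, t (U.card - 1)) *
          (∏ V ∈ FreeProb.innerBlocks α, (t (V.card - 1) + t V.card)) := by
  have hS := FreeProb.constantCoeff_sTransform φ a ha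
  have hT : PowerSeries.mk t * FreeProb.sTransform φ a ha = 1 := by
    rw [← ht]
    exact PowerSeries.inv_mul_cancel _ (by rw [hS]; exact one_ne_zero)
  have ht₀ : t 0 = 1 := by
    have := congrArg PowerSeries.constantCoeff hT
    rw [map_mul, hS, mul_one, map_one] at this
    simpa using this
  rw [FreeProb.sum_NC (fun V => t (V.card - 1)) fun V => t (V.card - 1) + t V.card,
    FreeProb.ncSum_eq_coeff_one_add ht₀ (PowerSeries.HasSubst.of_constantCoeff_zero'
      (FreeProb.constantCoeff_momentSeries φ a)) (FreeProb.momentSeries_eq φ a ha hT),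
    Finset.card_univ, Fintype.card_fin, map_add, PowerSeries.coeff_one, if_neg (by omega), zero_add,
    FreeProb.momentSeries, PowerSeries.coeff_mk, if_neg (by omega)]
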